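/- Let $\mathcal{T}=(\mathcal{V},\mathcal{E})$ be a finite tree, $\lambda>0$ and $\boldsymbol{\alpha}=(\alpha_e,\,e\in\mathcal{E})\in[0,1]^{\mathcal{E}}$. For a root $r\in\mathcal{V}$ let $\mathrm{pa}(v)$ denote the parent of $v\in\mathcal{V}\setminus\{r\}$, i.e. the neighbour of $v$ on the path from $v$ to $r$. Let $L_v$ ($v\in\mathcal{V}$) and $I_{e,i}$ ($e\in\mathcal{E}$, $i\ge 1$) be mutually independent random variables with $L_r\sim\mathrm{Poisson}(\lambda)$, $L_v\sim\mathrm{Poisson}(\lambda(1-\alpha_{(\mathrm{pa}(v),v)}))$ for $v\neq r$, and $I_{e,i}\sim\mathrm{Bernoulli}(\alpha_e)$, and define recursively from the root $$N_r=L_r,\qquad N_v=\sum_{i=1}^{N_{\mathrm{pa}(v)}} I_{(\mathrm{pa}(v),v),\,i}+L_v\quad (v\in\mathcal{V}\setminus\{r\}).$$ A random vector is said to be $\mathrm{MPMRF}(\lambda,\boldsymbol{\alpha},\mathcal{T})$-distributed if it has the joint distribution of such a vector $(N_v,\,v\in\mathcal{V})$ for some choice of the root $r$. For real random variables $X$ and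 $X'$ write $X\preceq_{cx}X'$ if $\mathrm{E}[\varphi(X)]\le \mathrm{E}[\varphi(X')]$ for every convex function $\varphi:\mathbb{R}\to\mathbb{R}$ for which both expectations exist (possibly as infinite values). Let $\boldsymbol{\alpha},\boldsymbol{\alpha}'\in[0,1]^{\mathcal{E}}$ satisfy $\alpha_e\le\alpha'_e$ for every $e\in\mathcal{E}$, let $\boldsymbol{N}\sim\mathrm{MPMRF}(\lambda,\boldsymbol{\alpha},\mathcal{T})$ and $\boldsymbol{N}'\sim\mathrm{MPMRF}(\lambda,\boldsymbol{\alpha}',\mathcal{T})$, and let $M=\sum_{v\in\mathcal{V}}N_v$ and $M'=\sum_{v\in\mathcal{V}}N'_v$. Then $$M\preceq_{cx}M'.$$ -/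

import Mathlib

open MeasureTheory ProbabilityTheory
open scoped NNReal ENNReal

namespace TreePoisson

/-- `u` is the parent of `v` in the tree `G` rooted at `r`: the neighbour of `v` that is one step
closer to the root. -/
def IsParent {V : Type*} (G : SimpleGraph V) (r u v : V) : Prop :=
  G.Adj u v ∧ G.dist r v = G.dist r u + 1

/-- Binomial thinning `α ∘ k`: the sum of the first `k` terms of a sequence of (Bernoulli)
indicators. -/
def thin (I : ℕ → ℕ) (k : ℕ) : ℕ := ∑ i ∈ Finset.range k, I i

/-- The stochastic construction on the tree `G` rooted at `r`: all the innovations `L v` and all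
the Bernoulli indicators `I e i` used in the thinnings along the edges are mutually independent,
`L r ∼ Poisson(lam)`, `L v ∼ Poisson(lam * (1 - α (pa v, v)))` for the other vertices,
`N r = L r`, and `N v = α (pa v, v) ∘ N (pa v) + L v` for the other vertices. -/
structure IsConstruction {V : Type*} (G : SimpleGraph V) (r : V) (lam : ℝ≥0)
    (α : G.edgeSet → unitInterval) {Ω : Type*} [MeasurableSpace Ω] (P : Measure Ω)
    (L : V → Ω → ℕ) (I : G.edgeSet → ℕ → Ω → ℕ) (N : V → Ω → ℕ) : Prop where
  indep : iIndepFun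
    (Sum.elim L (fun p : G.edgeSet × ℕ => I p.1 p.2) : V ⊕ (G.edgeSet × ℕ) → Ω → ℕ) P
  law_indicator : ∀ e i, HasLaw (I e i) (bernoulliMeasure 1 0 (α e)) P
  law_root : HasLaw (L r) (poissonMeasure lam) P
  law_child : ∀ u v (h : IsParent G r u v),
    HasLaw (L v) (poissonMeasure
      (lam * unitInterval.toNNReal (unitInterval.symm (α ⟨s(u, v), h.1⟩)))) P
  eq_root : ∀ ω, N r ω = L r ω
  eq_child : ∀ u v (h : IsParent G r u v) ω,
    N v ω = thin (fun i => I ⟨s(u, v), h.1⟩ i ω) (N u ω) + L v ω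

/-- `N ∼ MPMRF(lam, α, G)`: the joint law of the random vector `N` is that of the stochastic
construction on `G` with some choice of the root. -/
def IsMPMRF {V : Type*} (G : SimpleGraph V) (lam : ℝ≥0) (α : G.edgeSet → unitInterval)
    {Ω : Type*} [MeasurableSpace Ω] (P : Measure Ω) (N : V → Ω → ℕ) : Prop :=
  ∃ (r : V) (Ω₀ : Type) (_ : MeasurableSpace Ω₀) (P₀ : Measure Ω₀)
    (L : V → Ω₀ → ℕ) (I : G.edgeSet → ℕ → Ω₀ → ℕ) (N₀ : V → Ω₀ → ℕ),
    IsProbabilityMeasure P₀ ∧ IsConstruction G r lam α P₀ L I N₀ ∧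
      IdentDistrib (fun ω v => N v ω) (fun ω v => N₀ v ω) P P₀

/-- The expectation of `Y` exists, as an element of `[-∞, ∞]`: the positive part or the negative
part has a finite expectation. -/
def ExpectationExists {Ω : Type*} [MeasurableSpace Ω] (P : Measure Ω) (Y : Ω → ℝ) : Prop :=
  AEMeasurable Y P ∧
    ((∫⁻ ω, ENNReal.ofReal (Y ω) ∂P) ≠ ∞ ∨ (∫⁻ ω, ENNReal.ofReal (-Y ω) ∂P) ≠ ∞)

/-- The expectation with values in `[-∞, ∞]`, meaningful when `ExpectationExists P Y`. -/
noncomputable def expectation {Ω : Type*} [MeasurableSpace Ω] (P : Measure Ω) (Y : Ω → ℝ) :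
    EReal :=
  ((∫⁻ ω, ENNReal.ofReal (Y ω) ∂P : ℝ≥0∞) : EReal) -
    ((∫⁻ ω, ENNReal.ofReal (-Y ω) ∂P : ℝ≥0∞) : EReal)

/-- The convex order `X ≤_cx X'`: `E[φ(X)] ≤ E[φ(X')]` for every convex `φ : ℝ → ℝ` for which both
expectations exist (possibly infinite). -/
def ConvexOrder {Ω Ω' : Type*} [MeasurableSpace Ω] [MeasurableSpace Ω'] (P : Measure Ω)
    (X : Ω → ℝ) (P' : Measure Ω') (X' : Ω' → ℝ) : Prop :=
  ∀ φ : ℝ → ℝ, ConvexOn ℝ Set.univ φ →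
    ExpectationExists P (fun ω => φ (X ω)) → ExpectationExists P' (fun ω => φ (X' ω)) →
    expectation P (fun ω => φ (X ω)) ≤ expectation P' (fun ω => φ (X' ω))

end TreePoisson

/-! The joint law is a percolation mixture in the exponent. Keep each edge `e` open independently
with probability `α e`, and let `F` be the set of open edges. The joint generating function is the
exponential of the sum over `F` of `lam * openProb α univ F` times the sum over the clusters `C` of
`F` of `∏ v ∈ C, z v - 1` (`integral_prod_pow`). So `N` is distributed as if independent Poisson
variables `Y F C` of mean `lam * openProb α univ F` were each added to all the vertices of `C`. This
expression does not involve the root, and the total is distributed as the sum of the `C.card * Y F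
C`.

Raising one `α e` moves weight from each `F` not containing `e` to `insert e F`. In a forest,
opening `e` merges exactly two clusters, of sizes `a` and `b`, so a part `a * Y + b * Y'` of the
total is replaced by `(a + b) * Y`, where `Y` and `Y'` are independent with the same law. Convexity
makes this an increase in the convex order (`cxLE_scaledPoisson`), and convolution with the
unchanged part preserves the order (`CxLE.conv`). Raising the edges one by one gives the theorem.

No coupling is built: laws are identified by their characteristic functions, and `CxExp` transfers
the order to the exponents, which add under convolution. -/

namespace TreePoisson

/-! ### Convex order of laws on the line and its transfer to exponents. -/

/-- A convex function on the line lies above one of its tangents. -/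
lemma exists_affine_le {φ : ℝ → ℝ} (hφ : ConvexOn ℝ Set.univ φ) :
    ∃ c d : ℝ, ∀ x, c * x + d ≤ φ x := by
  have h0 : (0 : ℝ) ∈ interior (Set.univ : Set ℝ) := by simp
  refine ⟨derivWithin φ (Set.Ioi 0) 0, φ 0, fun x => ?_⟩
  rcases lt_trichotomy x 0 with hx | rfl | hx
  · have h1 := (hφ.slope_le_leftDeriv_of_mem_interior (Set.mem_univ x) h0 hx).trans
      (hφ.leftDeriv_le_rightDeriv_of_mem_interior h0)
    rw [slope_def_field, div_le_iff₀ (by linarith)] at h1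
    linarith
  · simp
  · have h1 := hφ.rightDeriv_le_slope_of_mem_interior h0 (Set.mem_univ x) hx
    rw [slope_def_field, le_div_iff₀ (by linarith)] at h1
    linarith

lemma _root_.ConvexOn.continuous_real {φ : ℝ → ℝ} (hφ : ConvexOn ℝ Set.univ φ) : Continuous φ :=
  continuousOn_univ.1 (hφ.continuousOn isOpen_univ)

/-- The convex order between integrable laws on the line, tested on nonnegative convex
functions. -/
structure CxLE (μ ν : Measure ℝ) : Prop where
  lintegral_le : ∀ ψ : ℝ → ℝ, ConvexOn ℝ Set.univ ψ → (∀ x, 0 ≤ ψ x) →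
    ∫⁻ x, ENNReal.ofReal (ψ x) ∂μ ≤ ∫⁻ x, ENNReal.ofReal (ψ x) ∂ν
  integrable_left : Integrable id μ
  integrable_right : Integrable id ν
  mean_eq : ∫ x, x ∂μ = ∫ x, x ∂ν

lemma CxLE.refl {μ : Measure ℝ} (h : Integrable id μ) : CxLE μ μ :=
  ⟨fun _ _ _ => le_rfl, h, h, rfl⟩

lemma CxLE.trans {μ ν ρ : Measure ℝ} (h : CxLE μ ν) (h' : CxLE ν ρ) : CxLE μ ρ :=
  ⟨fun ψ hψ h0 => (h.lintegral_le ψ hψ h0).trans (h'.lintegral_le ψ hψ h0),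
    h.integrable_left, h'.integrable_right, h.mean_eq.trans h'.mean_eq⟩

lemma integrable_id_conv {μ ν : Measure ℝ} [IsProbabilityMeasure μ] [IsProbabilityMeasure ν]
    (hμ : Integrable id μ) (hν : Integrable id ν) : Integrable id (μ ∗ ν) := by
  rw [Measure.conv, integrable_map_measure (by fun_prop) (by fun_prop)]
  exact (hμ.comp_fst ν).add (hν.comp_snd μ)

lemma integral_id_conv {μ ν : Measure ℝ} [IsProbabilityMeasure μ] [IsProbabilityMeasure ν]
    (hμ : Integrable id μ) (hν : Integrable id ν) :
    ∫ x, x ∂(μ ∗ ν) = ∫ x, x ∂μ + ∫ x, x ∂ν := by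
  have h1 : Integrable (fun x : ℝ × ℝ => x.1) (μ.prod ν) := hμ.comp_fst ν
  have h2 : Integrable (fun x : ℝ × ℝ => x.2) (μ.prod ν) := hν.comp_snd μ
  rw [Measure.conv, integral_map (by fun_prop) (by fun_prop), integral_add h1 h2,
    integral_fun_fst (fun x => x), integral_fun_snd (fun x => x)]
  simp

/-- Translates of convex functions are convex, so one factor can be replaced while the other
variable is frozen. Tonelli, valid for nonnegative test functions without integrability, exchanges
the roles in between. -/
lemma CxLE.conv {μ μ' ν ν' : Measure ℝ} [IsProbabilityMeasure μ] [IsProbabilityMeasure ν]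
    [IsProbabilityMeasure μ'] [IsProbabilityMeasure ν']
    (h : CxLE μ μ') (h' : CxLE ν ν') : CxLE (μ ∗ ν) (μ' ∗ ν') where
  integrable_left := integrable_id_conv h.integrable_left h'.integrable_left
  integrable_right := integrable_id_conv h.integrable_right h'.integrable_right
  mean_eq := by
    rw [integral_id_conv h.integrable_left h'.integrable_left,
      integral_id_conv h.integrable_right h'.integrable_right, h.mean_eq, h'.mean_eq]
  lintegral_le ψ hψ h0 := by
    have hm : Measurable fun x => ENNReal.ofReal (ψ x) :=
      hψ.continuous_real.measurable.ennreal_ofReal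
    calc ∫⁻ x, ENNReal.ofReal (ψ x) ∂(μ ∗ ν)
        = ∫⁻ x, ∫⁻ y, ENNReal.ofReal (ψ (x + y)) ∂ν ∂μ := Measure.lintegral_conv hm
      _ ≤ ∫⁻ x, ∫⁻ y, ENNReal.ofReal (ψ (x + y)) ∂ν' ∂μ :=
        lintegral_mono fun x => h'.lintegral_le (fun y => ψ (x + y))
          (by simpa [Function.comp_def] using hψ.translate_right x) fun y => h0 _
      _ = ∫⁻ y, ∫⁻ x, ENNReal.ofReal (ψ (x + y)) ∂μ ∂ν' := by
        refine lintegral_lintegral_swap (Measurable.aemeasurable ?_)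
        exact hm.comp (measurable_fst.add measurable_snd)
      _ ≤ ∫⁻ y, ∫⁻ x, ENNReal.ofReal (ψ (x + y)) ∂μ' ∂ν' :=
        lintegral_mono fun y => h.lintegral_le (fun x => ψ (x + y))
          (by simpa [Function.comp_def] using hψ.translate_left y) fun x => h0 _
      _ = ∫⁻ x, ∫⁻ y, ENNReal.ofReal (ψ (x + y)) ∂ν' ∂μ' := by
        refine (lintegral_lintegral_swap (Measurable.aemeasurable ?_)).symm
        exact hm.comp (measurable_fst.add measurable_snd)
      _ = _ := (Measure.lintegral_conv hm).symm

/-- `exp K` and `exp K'` are the characteristic functions of two laws in the convex order. -/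
def CxExp (K K' : ℝ → ℂ) : Prop :=
  ∃ μ μ' : Measure ℝ, IsProbabilityMeasure μ ∧ IsProbabilityMeasure μ' ∧
    (∀ t, charFun μ t = Complex.exp (K t)) ∧ (∀ t, charFun μ' t = Complex.exp (K' t)) ∧ CxLE μ μ'

lemma CxExp.zero : CxExp 0 0 :=
  ⟨Measure.dirac 0, Measure.dirac 0, inferInstance, inferInstance, by simp, by simp,
    CxLE.refl (integrable_dirac (by simp))⟩

lemma CxExp.add {K K' J J' : ℝ → ℂ} (h : CxExp K K') (h' : CxExp J J') :
    CxExp (K + J) (K' + J') := by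
  obtain ⟨μ, μ', _, _, h1, h2, h3⟩ := h
  obtain ⟨ν, ν', _, _, h1', h2', h3'⟩ := h'
  refine ⟨μ ∗ ν, μ' ∗ ν', inferInstance, inferInstance, fun t => ?_, fun t => ?_, h3.conv h3'⟩
  · rw [charFun_conv, h1, h1', ← Complex.exp_add, Pi.add_apply]
  · rw [charFun_conv, h2, h2', ← Complex.exp_add, Pi.add_apply]

lemma CxExp.sum {ι : Type*} (s : Finset ι) {K K' : ι → ℝ → ℂ}
    (h : ∀ i ∈ s, CxExp (K i) (K' i)) : CxExp (∑ i ∈ s, K i) (∑ i ∈ s, K' i) := by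
  classical
  induction s using Finset.induction_on with
  | empty => simpa using CxExp.zero
  | insert a s ha ih =>
    rw [Finset.sum_insert ha, Finset.sum_insert ha]
    exact (h a (Finset.mem_insert_self a s)).add
      (ih fun i hi => h i (Finset.mem_insert_of_mem hi))

/-- The two middle laws coincide because a characteristic function determines its law. -/
lemma CxExp.trans {K K' K'' : ℝ → ℂ} (h : CxExp K K') (h' : CxExp K' K'') : CxExp K K'' := by
  obtain ⟨μ, μ', _, _, h1, h2, h3⟩ := h
  obtain ⟨ν, ν', _, _, h1', h2', h3'⟩ := h'
  have : μ' = ν := Measure.ext_of_charFun (by ext t; rw [h2, h1'])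
  subst this
  exact ⟨μ, ν', inferInstance, inferInstance, h1, h2', h3.trans h3'⟩

/-! ### Scaled Poisson laws and the merging inequality. -/

/-- The law of `a * Y` where `Y` has a Poisson law. -/
noncomputable def scaledPoisson (a : ℝ) (s : ℝ≥0) : Measure ℝ :=
  (poissonMeasure s).map (fun n : ℕ => a * (n : ℝ))

instance (a : ℝ) (s : ℝ≥0) : IsProbabilityMeasure (scaledPoisson a s) :=
  Measure.isProbabilityMeasure_map (by fun_prop)

lemma charFun_scaledPoisson (a : ℝ) (s : ℝ≥0) (t : ℝ) :
    charFun (scaledPoisson a s) t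
      = Complex.exp (s * (Complex.exp ((a * t : ℝ) * Complex.I) - 1)) := by
  rw [scaledPoisson, charFun_map_mul_comp (by fun_prop), charFun_map_cast_poissonMeasure]

lemma integrable_cast_poissonMeasure (s : ℝ≥0) :
    Integrable (fun n : ℕ => (n : ℝ)) (poissonMeasure s) := by
  rw [integrable_poissonMeasure_iff]
  rw [← summable_nat_add_iff 1]
  refine ((Real.summable_pow_div_factorial (s : ℝ)).mul_left (Real.exp (-s) * s)).congr
    fun n => ?_
  rw [Nat.factorial_succ]
  have := Nat.factorial_pos n
  push_cast
  rw [Real.norm_of_nonneg (by positivity)]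
  field_simp
  ring

lemma integrable_id_scaledPoisson (a : ℝ) (s : ℝ≥0) : Integrable id (scaledPoisson a s) := by
  rw [scaledPoisson, integrable_map_measure (by fun_prop) (by fun_prop)]
  exact (integrable_cast_poissonMeasure s).const_mul a

lemma integral_id_scaledPoisson (a : ℝ) (s : ℝ≥0) :
    ∫ x, x ∂(scaledPoisson a s) = a * ∫ n : ℕ, (n : ℝ) ∂(poissonMeasure s) := by
  rw [scaledPoisson, integral_map (by fun_prop) (by fun_prop), integral_const_mul]

lemma lintegral_scaledPoisson (a : ℝ) (s : ℝ≥0) {f : ℝ → ℝ≥0∞} (hf : Measurable f) :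
    ∫⁻ x, f x ∂(scaledPoisson a s) = ∫⁻ n : ℕ, f (a * n) ∂(poissonMeasure s) := by
  rw [scaledPoisson, lintegral_map hf (by fun_prop)]

/-- Merging two independent Poisson variables increases the sum in the convex order. -/
lemma cxLE_scaledPoisson {a b : ℝ} (ha : 0 < a) (hb : 0 < b) (s : ℝ≥0) :
    CxLE (scaledPoisson a s ∗ scaledPoisson b s) (scaledPoisson (a + b) s) where
  integrable_left :=
    integrable_id_conv (integrable_id_scaledPoisson a s) (integrable_id_scaledPoisson b s)
  integrable_right := integrable_id_scaledPoisson _ s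
  mean_eq := by
    rw [integral_id_conv (integrable_id_scaledPoisson a s) (integrable_id_scaledPoisson b s)]
    simp only [integral_id_scaledPoisson]
    ring
  lintegral_le ψ hψ h0 := by
    have hm : Measurable fun x => ENNReal.ofReal (ψ x) :=
      hψ.continuous_real.measurable.ennreal_ofReal
    -- The point `a x + b y` is the mean of `(a + b) x` and `(a + b) y` with weights `a / (a + b)`
    -- and `b / (a + b)`. As `x` and `y` have the same law, integrating merges the two bounds into
    -- one integral of total weight one.
    have key : ∀ x y : ℕ, ENNReal.ofReal (ψ (a * x + b * y)) ≤
        ENNReal.ofReal (a / (a + b)) * ENNReal.ofReal (ψ ((a + b) * x)) +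
          ENNReal.ofReal (b / (a + b)) * ENNReal.ofReal (ψ ((a + b) * y)) := by
      intro x y
      rw [← ENNReal.ofReal_mul (by positivity), ← ENNReal.ofReal_mul (by positivity),
        ← ENNReal.ofReal_add (mul_nonneg (by positivity) (h0 _))
          (mul_nonneg (by positivity) (h0 _))]
      apply ENNReal.ofReal_le_ofReal
      have hw : a / (a + b) + b / (a + b) = 1 := by field_simp
      have := hψ.2 (Set.mem_univ ((a + b) * (x : ℝ))) (Set.mem_univ ((a + b) * (y : ℝ)))
        (by positivity : 0 ≤ a / (a + b)) (by positivity : 0 ≤ b / (a + b)) hw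
      simp only [smul_eq_mul] at this
      rwa [show a / (a + b) * ((a + b) * x) + b / (a + b) * ((a + b) * y) = a * x + b * (y : ℝ) by
        field_simp] at this
    rw [Measure.lintegral_conv hm, lintegral_scaledPoisson (a + b) s hm]
    rw [lintegral_scaledPoisson a s (Measurable.lintegral_prod_right'
      (f := fun p : ℝ × ℝ => ENNReal.ofReal (ψ (p.1 + p.2)))
      (hm.comp (measurable_fst.add measurable_snd)))]
    have e : ∀ x : ℕ, ∫⁻ y, ENNReal.ofReal (ψ (a * x + y)) ∂(scaledPoisson b s)
        = ∫⁻ y : ℕ, ENNReal.ofReal (ψ (a * x + b * y)) ∂(poissonMeasure s) := fun x =>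
      lintegral_scaledPoisson b s (f := fun y => ENNReal.ofReal (ψ (a * x + y)))
        (hm.comp (measurable_const.add measurable_id))
    simp only [e]
    calc ∫⁻ x : ℕ, ∫⁻ y : ℕ, ENNReal.ofReal (ψ (a * x + b * y)) ∂(poissonMeasure s)
          ∂(poissonMeasure s)
        ≤ ∫⁻ x : ℕ, ∫⁻ y : ℕ, (ENNReal.ofReal (a / (a + b)) * ENNReal.ofReal (ψ ((a + b) * x)) +
          ENNReal.ofReal (b / (a + b)) * ENNReal.ofReal (ψ ((a + b) * y))) ∂(poissonMeasure s)
          ∂(poissonMeasure s) := lintegral_mono fun x => lintegral_mono fun y => key x y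
      _ = _ := by
        simp only [lintegral_add_left (measurable_const : Measurable fun _ : ℕ => (_ : ℝ≥0∞)),
          lintegral_const, measure_univ, mul_one]
        rw [lintegral_add_right _ measurable_const, lintegral_const, measure_univ, mul_one,
          lintegral_const_mul _ (Measurable.of_discrete),
          lintegral_const_mul _ (Measurable.of_discrete),
          ← add_mul, ← ENNReal.ofReal_add (by positivity) (by positivity), ← add_div,
          div_self (by positivity), ENNReal.ofReal_one, one_mul]

/-- The exponent of the characteristic function of `a * Y`, with `Y` Poisson of mean `s`. -/
noncomputable def jumpExponent (s : ℝ≥0) (a : ℕ) (t : ℝ) : ℂ :=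
  s * (Complex.exp (t * Complex.I) ^ a - 1)

lemma charFun_scaledPoisson_nat (a : ℕ) (s : ℝ≥0) (t : ℝ) :
    charFun (scaledPoisson a s) t = Complex.exp (jumpExponent s a t) := by
  rw [charFun_scaledPoisson, jumpExponent, ← Complex.exp_nat_mul]
  push_cast
  ring_nf

lemma cxExp_jumpExponent (s : ℝ≥0) (a : ℕ) : CxExp (jumpExponent s a) (jumpExponent s a) :=
  ⟨scaledPoisson a s, scaledPoisson a s, inferInstance, inferInstance,
    charFun_scaledPoisson_nat a s, charFun_scaledPoisson_nat a s,
    CxLE.refl (integrable_id_scaledPoisson _ s)⟩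

lemma cxExp_jumpExponent_add (s : ℝ≥0) {a b : ℕ} (ha : 0 < a) (hb : 0 < b) :
    CxExp (jumpExponent s a + jumpExponent s b) (jumpExponent s (a + b)) :=
  ⟨scaledPoisson a s ∗ scaledPoisson b s, scaledPoisson (a + b : ℕ) s, inferInstance,
    inferInstance, fun t => by
      rw [charFun_conv, charFun_scaledPoisson_nat, charFun_scaledPoisson_nat,
        ← Complex.exp_add, Pi.add_apply],
    charFun_scaledPoisson_nat _ s, by
      rw [Nat.cast_add]
      exact cxLE_scaledPoisson (by exact_mod_cast ha) (by exact_mod_cast hb) s⟩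

/-! ### From nonnegative test functions to extended-valued expectations. -/

lemma lintegral_ofReal_ne_top_of_le {μ : Measure ℝ} {f g : ℝ → ℝ} (hg : Integrable g μ)
    (hfg : ∀ x, f x ≤ g x) : ∫⁻ x, ENNReal.ofReal (f x) ∂μ ≠ ∞ :=
  ((lintegral_mono fun x => ENNReal.ofReal_le_ofReal (hfg x)).trans_lt
    (hg.lintegral_lt_top)).ne

lemma expectation_eq_integral {Ω : Type*} [MeasurableSpace Ω] {P : Measure Ω} {Y : Ω → ℝ}
    (hY : Integrable Y P) : expectation P Y = ((∫ ω, Y ω ∂P : ℝ) : EReal) := by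
  rw [integral_eq_lintegral_pos_part_sub_lintegral_neg_part hY, expectation, EReal.coe_sub,
    EReal.coe_ennreal_toReal hY.lintegral_lt_top.ne,
    EReal.coe_ennreal_toReal (x := ∫⁻ ω, ENNReal.ofReal (-Y ω) ∂P) hY.neg.lintegral_lt_top.ne]

/-- Subtracting a supporting line leaves a nonnegative convex function, to which the order applies
directly; the line itself has the same integral under both laws by equality of means. The line also
bounds the negative part, so the right-hand expectation is either `⊤` or an ordinary integral. -/
lemma CxLE.expectation_le {μ ν : Measure ℝ} [IsProbabilityMeasure μ] [IsProbabilityMeasure ν]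
    (h : CxLE μ ν) {φ : ℝ → ℝ} (hφ : ConvexOn ℝ Set.univ φ) :
    expectation μ φ ≤ expectation ν φ := by
  obtain ⟨c, d, hcd⟩ := exists_affine_le hφ
  have hφm := hφ.continuous_real.measurable
  set ψ : ℝ → ℝ := fun x => φ x - (c * x + d) with hψ
  have hψ0 : ∀ x, 0 ≤ ψ x := fun x => sub_nonneg.2 (hcd x)
  have hψc : ConvexOn ℝ Set.univ ψ := by
    refine hφ.sub ⟨convex_univ, fun x _ y _ a b _ _ hab => ?_⟩
    simp only [smul_eq_mul]
    linear_combination d * hab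
  have hle := h.lintegral_le ψ hψc hψ0
  have hμa : Integrable (fun x => c * x + d) μ :=
    (h.integrable_left.const_mul c).add (integrable_const d)
  have hνa : Integrable (fun x => c * x + d) ν :=
    (h.integrable_right.const_mul c).add (integrable_const d)
  have hψm : Measurable ψ := by fun_prop
  have hneg : ∫⁻ x, ENNReal.ofReal (-φ x) ∂ν ≠ ∞ :=
    lintegral_ofReal_ne_top_of_le hνa.neg fun x => neg_le_neg (hcd x)
  by_cases hfin : ∫⁻ x, ENNReal.ofReal (ψ x) ∂ν = ∞
  · have htop : ∫⁻ x, ENNReal.ofReal (φ x) ∂ν = ∞ := by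
      by_contra hne
      have h1 : ∫⁻ x, ENNReal.ofReal (ψ x) ∂ν ≤
          ∫⁻ x, ENNReal.ofReal (φ x) ∂ν + ∫⁻ x, ENNReal.ofReal (-(c * x + d)) ∂ν := by
        rw [← lintegral_add_left (by fun_prop)]
        refine lintegral_mono fun x => ?_
        exact (congrArg ENNReal.ofReal (sub_eq_add_neg (φ x) _)).trans_le ENNReal.ofReal_add_le
      rw [hfin, top_le_iff, ENNReal.add_eq_top] at h1
      exact h1.elim hne hνa.neg.lintegral_lt_top.ne
    have : expectation ν φ = ⊤ := by
      rw [expectation, htop, EReal.coe_ennreal_top, EReal.top_sub]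
      simpa using hneg
    rw [this]
    exact le_top
  · have hψν : Integrable ψ ν := (lintegral_ofReal_ne_top_iff_integrable
      hψm.aestronglyMeasurable (Filter.Eventually.of_forall hψ0)).1 hfin
    have hψμ : Integrable ψ μ := (lintegral_ofReal_ne_top_iff_integrable
      hψm.aestronglyMeasurable (Filter.Eventually.of_forall hψ0)).1
      (hle.trans_lt (lt_top_iff_ne_top.2 hfin)).ne
    have e : φ = fun x => ψ x + (c * x + d) := by ext x; simp [hψ]
    rw [e, expectation_eq_integral (Y := fun x => ψ x + (c * x + d)) (hψμ.add hμa),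
      expectation_eq_integral (Y := fun x => ψ x + (c * x + d)) (hψν.add hνa),
      EReal.coe_le_coe_iff, integral_add hψμ hμa, integral_add hψν hνa]
    refine add_le_add ?_ (le_of_eq ?_)
    · rw [integral_eq_lintegral_of_nonneg_ae (Filter.Eventually.of_forall hψ0)
        hψm.aestronglyMeasurable, integral_eq_lintegral_of_nonneg_ae
        (Filter.Eventually.of_forall hψ0) hψm.aestronglyMeasurable]
      exact ENNReal.toReal_mono hfin hle
    · have hc := h.mean_eq
      have hμ : Integrable (fun x => c * x) μ := h.integrable_left.const_mul c
      have hν : Integrable (fun x => c * x) ν := h.integrable_right.const_mul c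
      rw [integral_add hμ (integrable_const d), integral_add hν (integrable_const d)]
      rw [integral_const_mul, integral_const_mul, hc]
      simp

lemma expectation_map {Ω : Type*} [MeasurableSpace Ω] {P : Measure Ω} {X : Ω → ℝ}
    (hX : AEMeasurable X P) {φ : ℝ → ℝ} (hφ : Measurable φ) :
    expectation (P.map X) φ = expectation P (fun ω => φ (X ω)) := by
  rw [expectation, lintegral_map' (by fun_prop) hX, lintegral_map' (by fun_prop) hX, expectation]

lemma CxExp.convexOrder {K K' : ℝ → ℂ} (h : CxExp K K') {Ω Ω' : Type*} [MeasurableSpace Ω]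
    [MeasurableSpace Ω'] {P : Measure Ω} [IsProbabilityMeasure P] {P' : Measure Ω'}
    [IsProbabilityMeasure P'] {X : Ω → ℝ} {X' : Ω' → ℝ}
    (hX : AEMeasurable X P) (hX' : AEMeasurable X' P')
    (hK : ∀ t, charFun (P.map X) t = Complex.exp (K t))
    (hK' : ∀ t, charFun (P'.map X') t = Complex.exp (K' t)) : ConvexOrder P X P' X' := by
  obtain ⟨μ, μ', _, _, h1, h2, h3⟩ := h
  have := Measure.isProbabilityMeasure_map hX
  have := Measure.isProbabilityMeasure_map hX'
  have e : P.map X = μ := Measure.ext_of_charFun (by ext t; rw [hK, h1])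
  have e' : P'.map X' = μ' := Measure.ext_of_charFun (by ext t; rw [hK', h2])
  subst e e'
  intro φ hφ _ _
  have hφm := hφ.continuous_real.measurable
  rw [← expectation_map hX hφm, ← expectation_map hX' hφm]
  exact h3.expectation_le hφ

/-! ### Open edge sets, their clusters and their probabilities. -/

section Percolation

open scoped Classical

variable {V : Type*} {G : SimpleGraph V}

/-- The spanning subgraph of `G` with edge set `F`. -/
def openGraph (F : Finset G.edgeSet) : SimpleGraph V where
  Adj u v := ∃ e ∈ F, e.1 = s(u, v)
  symm := ⟨fun u v ⟨e, he, h⟩ => ⟨e, he, h.trans Sym2.eq_swap⟩⟩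
  loopless := ⟨fun u ⟨e, _, h⟩ => G.loopless.irrefl u (by
    rw [← SimpleGraph.mem_edgeSet, ← h]; exact e.2)⟩

lemma openGraph_mono {F F' : Finset G.edgeSet} (h : F ⊆ F') : openGraph F ≤ openGraph F' :=
  fun _ _ ⟨e, he, h'⟩ => ⟨e, h he, h'⟩

lemma openGraph_le (F : Finset G.edgeSet) : openGraph F ≤ G := fun u v ⟨e, _, h⟩ => by
  rw [← SimpleGraph.mem_edgeSet, ← h]; exact e.2

/-- A walk may cross the new edge repeatedly, but induction from its far end reduces it to at most
one crossing, in one of the two directions. -/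
lemma reachable_openGraph_insert {F : Finset G.edgeSet} {u w : V} (h : G.Adj u w) {x y : V} :
    (openGraph (insert ⟨s(u, w), h⟩ F)).Reachable x y ↔ (openGraph F).Reachable x y ∨
      ((openGraph F).Reachable x u ∧ (openGraph F).Reachable w y) ∨
      ((openGraph F).Reachable x w ∧ (openGraph F).Reachable u y) := by
  have hle := openGraph_mono (Finset.subset_insert (⟨s(u, w), h⟩ : G.edgeSet) F)
  have huw : (openGraph (insert ⟨s(u, w), h⟩ F)).Reachable u w :=
    SimpleGraph.Adj.reachable ⟨⟨s(u, w), h⟩, Finset.mem_insert_self _ _, rfl⟩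
  constructor
  · rintro ⟨p⟩
    induction p with
    | nil => exact Or.inl (SimpleGraph.Reachable.refl _)
    | cons ha q ih =>
      obtain ⟨e, he, hes⟩ := ha
      rcases Finset.mem_insert.1 he with rfl | he
      · rcases Sym2.eq_iff.1 hes with ⟨rfl, rfl⟩ | ⟨rfl, rfl⟩
        · rcases ih with ih | ih | ih
          · exact Or.inr (Or.inl ⟨SimpleGraph.Reachable.refl _, ih⟩)
          · exact Or.inr (Or.inl ⟨SimpleGraph.Reachable.refl _, ih.2⟩)
          · exact Or.inl ih.2
        · rcases ih with ih | ih | ih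
          · exact Or.inr (Or.inr ⟨SimpleGraph.Reachable.refl _, ih⟩)
          · exact Or.inl ih.2
          · exact Or.inr (Or.inr ⟨SimpleGraph.Reachable.refl _, ih.2⟩)
      · have hr := SimpleGraph.Adj.reachable (G := openGraph F) ⟨e, he, hes⟩
        rcases ih with ih | ih | ih
        · exact Or.inl (hr.trans ih)
        · exact Or.inr (Or.inl ⟨hr.trans ih.1, ih.2⟩)
        · exact Or.inr (Or.inr ⟨hr.trans ih.1, ih.2⟩)
  · rintro (h' | ⟨h1, h2⟩ | ⟨h1, h2⟩)
    · exact h'.mono hle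
    · exact (h1.mono hle).trans (huw.trans (h2.mono hle))
    · exact (h1.mono hle).trans (huw.symm.trans (h2.mono hle))

/-- The probability that, among the edges in `T`, exactly those in `F` are open, when `e` is open
with probability `α e`. -/
noncomputable def openProb (α : G.edgeSet → unitInterval) (T F : Finset G.edgeSet) : ℝ≥0 :=
  (∏ e ∈ F, unitInterval.toNNReal (α e)) *
    ∏ e ∈ T \ F, unitInterval.toNNReal (unitInterval.symm (α e))

lemma sum_openProb (α : G.edgeSet → unitInterval) (T : Finset G.edgeSet) :
    ∑ F ∈ T.powerset, openProb α T F = 1 := by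
  simp only [openProb]
  rw [← Finset.prod_add]
  simp

lemma openProb_congr {α β : G.edgeSet → unitInterval} {T F : Finset G.edgeSet} (hF : F ⊆ T)
    (h : ∀ e ∈ T, α e = β e) : openProb α T F = openProb β T F := by
  rw [openProb, openProb]
  congr 1
  · exact Finset.prod_congr rfl fun e he => by rw [h e (hF he)]
  · exact Finset.prod_congr rfl fun e he => by rw [h e (Finset.mem_sdiff.1 he).1]

variable [Fintype V]

/-- The vertex set of the connected component of `v` when only the edges in `F` are kept. -/
noncomputable def cluster (F : Finset G.edgeSet) (v : V) : Finset V :=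
  Finset.univ.filter fun w => (openGraph F).Reachable v w

/-- The vertex sets of the connected components when only the edges in `F` are kept. -/
noncomputable def clusters (F : Finset G.edgeSet) : Finset (Finset V) :=
  Finset.univ.image (cluster F)

lemma mem_cluster {F : Finset G.edgeSet} {v w : V} :
    w ∈ cluster F v ↔ (openGraph F).Reachable v w := by simp [cluster]

lemma self_mem_cluster (F : Finset G.edgeSet) (v : V) : v ∈ cluster F v :=
  mem_cluster.2 (SimpleGraph.Reachable.refl v)

lemma cluster_eq_of_mem {F : Finset G.edgeSet} {v w : V} (h : w ∈ cluster F v) :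
    cluster F w = cluster F v := by
  ext x
  rw [mem_cluster] at *
  rw [mem_cluster]
  exact ⟨h.trans, h.symm.trans⟩

lemma eq_cluster_of_mem {F : Finset G.edgeSet} {C : Finset V} (hC : C ∈ clusters F) {v : V}
    (hv : v ∈ C) : C = cluster F v := by
  obtain ⟨x, -, rfl⟩ := Finset.mem_image.1 hC
  exact (cluster_eq_of_mem hv).symm

lemma cluster_mem_clusters (F : Finset G.edgeSet) (v : V) : cluster F v ∈ clusters F :=
  Finset.mem_image_of_mem _ (Finset.mem_univ v)

/-- Opening an edge between two distinct clusters merges these and leaves the others as they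
are. -/
lemma exists_clusters_insert {F : Finset G.edgeSet} {u w : V} (h : G.Adj u w)
    (huw : w ∉ cluster F u) :
    ∃ D : Finset (Finset V), (∀ C ∈ D, u ∉ C ∧ w ∉ C) ∧
      clusters F = insert (cluster F u) (insert (cluster F w) D) ∧
      clusters (insert ⟨s(u, w), h⟩ F) = insert (cluster F u ∪ cluster F w) D := by
  have hu : cluster (insert ⟨s(u, w), h⟩ F) u = cluster F u ∪ cluster F w := by
    ext y
    simp only [mem_cluster, Finset.mem_union, reachable_openGraph_insert h] at huw ⊢
    have := SimpleGraph.Reachable.refl (G := openGraph F) u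
    tauto
  have hother : ∀ x, x ∉ cluster F u → x ∉ cluster F w →
      cluster (insert ⟨s(u, w), h⟩ F) x = cluster F x := by
    intro x hxu hxw
    ext y
    simp only [mem_cluster, reachable_openGraph_insert h] at hxu hxw ⊢
    have h1 : ¬ (openGraph F).Reachable x u := fun hh => hxu hh.symm
    have h2 : ¬ (openGraph F).Reachable x w := fun hh => hxw hh.symm
    tauto
  refine ⟨(Finset.univ.filter fun x => x ∉ cluster F u ∧ x ∉ cluster F w).image (cluster F),
    ?_, ?_, ?_⟩
  · intro C hC
    obtain ⟨x, hx, rfl⟩ := Finset.mem_image.1 hC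
    have hx := (Finset.mem_filter.1 hx).2
    refine ⟨fun hh => hx.1 ?_, fun hh => hx.2 ?_⟩
    · rw [cluster_eq_of_mem hh]; exact self_mem_cluster F x
    · rw [cluster_eq_of_mem hh]; exact self_mem_cluster F x
  · ext C
    simp only [clusters, Finset.mem_insert, Finset.mem_image, Finset.mem_filter, Finset.mem_univ,
      true_and]
    constructor
    · rintro ⟨x, rfl⟩
      by_cases hxu : x ∈ cluster F u
      · exact Or.inl (cluster_eq_of_mem hxu)
      by_cases hxw : x ∈ cluster F w
      · exact Or.inr (Or.inl (cluster_eq_of_mem hxw))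
      exact Or.inr (Or.inr ⟨x, ⟨hxu, hxw⟩, rfl⟩)
    · rintro (rfl | rfl | ⟨x, -, rfl⟩)
      exacts [⟨u, rfl⟩, ⟨w, rfl⟩, ⟨x, rfl⟩]
  · ext C
    simp only [clusters, Finset.mem_insert, Finset.mem_image, Finset.mem_filter, Finset.mem_univ,
      true_and]
    constructor
    · rintro ⟨x, rfl⟩
      by_cases hx : x ∈ cluster F u ∪ cluster F w
      · left
        rw [← hu] at hx ⊢
        exact cluster_eq_of_mem hx
      · rw [Finset.mem_union, not_or] at hx
        exact Or.inr ⟨x, hx, (hother x hx.1 hx.2).symm⟩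
    · rintro (rfl | ⟨x, hx, rfl⟩)
      exacts [⟨u, hu⟩, ⟨x, hother x hx.1 hx.2⟩]

/-- A single `D` serves every summand `f`, so that sums for two different vectors `z` and `z'` can
be compared term by term on the untouched clusters. -/
lemma exists_sum_clusters_insert {F : Finset G.edgeSet} {u w : V} (h : G.Adj u w)
    (huw : w ∉ cluster F u) :
    ∃ D : Finset (Finset V), (∀ C ∈ D, u ∉ C ∧ w ∉ C) ∧
      ∀ {M : Type} [AddCommMonoid M] (f : Finset V → M),
        ∑ C ∈ clusters F, f C = (f (cluster F u) + f (cluster F w)) + ∑ C ∈ D, f C ∧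
        ∑ C ∈ clusters (insert ⟨s(u, w), h⟩ F), f C =
          f (cluster F u ∪ cluster F w) + ∑ C ∈ D, f C := by
  obtain ⟨D, hD, h1, h2⟩ := exists_clusters_insert h huw
  refine ⟨D, hD, fun f => ⟨?_, ?_⟩⟩
  · rw [h1, Finset.sum_insert, Finset.sum_insert, add_assoc]
    · exact fun hh => (hD _ hh).2 (self_mem_cluster F w)
    · intro hh
      rcases Finset.mem_insert.1 hh with hh | hh
      · exact huw (hh ▸ self_mem_cluster F w)
      · exact (hD _ hh).1 (self_mem_cluster F u)
  · rw [h2, Finset.sum_insert]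
    exact fun hh => (hD _ hh).1 (Finset.mem_union_left _ (self_mem_cluster F u))

lemma disjoint_cluster {F : Finset G.edgeSet} {u w : V} (huw : w ∉ cluster F u) :
    Disjoint (cluster F u) (cluster F w) := by
  rw [Finset.disjoint_left]
  intro x hxu hxw
  rw [mem_cluster] at *
  exact huw (hxu.trans hxw.symm)

/-- Every edge of a forest is a bridge, so its ends are separated as long as it is closed. -/
lemma notMem_cluster_of_isAcyclic (hG : G.IsAcyclic) {F : Finset G.edgeSet} {u w : V}
    (h : G.Adj u w) (hF : (⟨s(u, w), h⟩ : G.edgeSet) ∉ F) : w ∉ cluster F u := by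
  rw [mem_cluster]
  intro hr
  have hb := SimpleGraph.isBridge_iff.1 (SimpleGraph.isAcyclic_iff_forall_adj_isBridge.1 hG h)
  refine hb (hr.mono ?_)
  rintro x y ⟨e, he, hes⟩
  rw [SimpleGraph.deleteEdges_adj]
  refine ⟨openGraph_le F ⟨e, he, hes⟩, fun hh => hF ?_⟩
  have : e = ⟨s(u, w), h⟩ := Subtype.ext (hes.trans hh)
  exact this ▸ he

lemma openProb_univ_of_notMem (α : G.edgeSet → unitInterval) {F : Finset G.edgeSet}
    {e : G.edgeSet} (he : e ∉ F) : openProb α Finset.univ F =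
      openProb α (Finset.univ.erase e) F * unitInterval.toNNReal (unitInterval.symm (α e)) := by
  have : Finset.univ \ F = insert e (Finset.univ.erase e \ F) := by
    ext x; by_cases hx : x = e <;> simp [hx, he]
  rw [openProb, openProb, this, Finset.prod_insert (by simp)]
  ring

lemma openProb_univ_insert (α : G.edgeSet → unitInterval) {F : Finset G.edgeSet}
    {e : G.edgeSet} (he : e ∉ F) : openProb α Finset.univ (insert e F) =
      openProb α (Finset.univ.erase e) F * unitInterval.toNNReal (α e) := by
  have : Finset.univ \ insert e F = Finset.univ.erase e \ F := by
    ext x; by_cases hx : x = e <;> simp [hx]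
  rw [openProb, openProb, this, Finset.prod_insert he]
  ring

/-- Conditioning on the state of `e`. The weight is an argument of `f` so that the identity applies
both to complex sums and to sums of exponents. -/
lemma sum_openProb_split {M : Type*} [AddCommMonoid M] (α : G.edgeSet → unitInterval)
    (e : G.edgeSet) (f : ℝ≥0 → Finset G.edgeSet → M) :
    ∑ F ∈ Finset.univ.powerset, f (openProb α Finset.univ F) F =
      ∑ F ∈ (Finset.univ.erase e).powerset,
        (f (openProb α (Finset.univ.erase e) F *
            unitInterval.toNNReal (unitInterval.symm (α e))) F +
          f (openProb α (Finset.univ.erase e) F * unitInterval.toNNReal (α e)) (insert e F)) := by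
  rw [← Finset.insert_erase (Finset.mem_univ e), Finset.sum_powerset_insert (by simp),
    Finset.insert_erase (Finset.mem_univ e), ← Finset.sum_add_distrib]
  refine Finset.sum_congr rfl fun F hF => ?_
  have he : e ∉ F := fun hh => by simpa using Finset.mem_powerset.1 hF hh
  rw [openProb_univ_of_notMem α he, openProb_univ_insert α he]

/-! ### Exponents of the total and their monotonicity in the edge parameters. -/

/-- The exponent of the characteristic function of the sum of `|C| * Y C` over the clusters `C`,
the `Y C` being independent Poisson variables of mean `s`. -/
noncomputable def clusterExponent (F : Finset G.edgeSet) (s : ℝ≥0) : ℝ → ℂ :=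
  ∑ C ∈ clusters F, jumpExponent s C.card

lemma jumpExponent_add (s s' : ℝ≥0) (a : ℕ) :
    jumpExponent (s + s') a = jumpExponent s a + jumpExponent s' a := by
  ext t
  simp only [jumpExponent, Pi.add_apply]
  push_cast
  ring

lemma clusterExponent_add (F : Finset G.edgeSet) (s s' : ℝ≥0) :
    clusterExponent F (s + s') = clusterExponent F s + clusterExponent F s' := by
  simp only [clusterExponent, jumpExponent_add, Finset.sum_add_distrib]

lemma cxExp_clusterExponent (F : Finset G.edgeSet) (s : ℝ≥0) :
    CxExp (clusterExponent F s) (clusterExponent F s) :=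
  CxExp.sum _ fun _ _ => cxExp_jumpExponent s _

lemma cxExp_clusterExponent_insert (hG : G.IsAcyclic) {F : Finset G.edgeSet} {e : G.edgeSet}
    (he : e ∉ F) (s : ℝ≥0) : CxExp (clusterExponent F s) (clusterExponent (insert e F) s) := by
  obtain ⟨e, h⟩ := e
  induction e with | _ u w
  have huw := notMem_cluster_of_isAcyclic hG h he
  obtain ⟨D, -, hsum⟩ := exists_sum_clusters_insert h huw
  obtain ⟨h1, h2⟩ := hsum fun C => jumpExponent s C.card
  rw [clusterExponent, clusterExponent, h1, h2,
    Finset.card_union_of_disjoint (disjoint_cluster huw)]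
  exact (cxExp_jumpExponent_add s (Finset.card_pos.2 ⟨u, self_mem_cluster F u⟩)
    (Finset.card_pos.2 ⟨w, self_mem_cluster F w⟩)).add
    (CxExp.sum _ fun _ _ => cxExp_jumpExponent s _)

/-- The exponent of the characteristic function of the sum of the components of a vector with law
`MPMRF(lam, α, G)`. -/
noncomputable def totalExponent (lam : ℝ≥0) (α : G.edgeSet → unitInterval) : ℝ → ℂ :=
  ∑ F ∈ Finset.univ.powerset, clusterExponent F (lam * openProb α Finset.univ F)

lemma cxExp_totalExponent (lam : ℝ≥0) (α : G.edgeSet → unitInterval) :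
    CxExp (totalExponent lam α) (totalExponent lam α) :=
  CxExp.sum _ fun _ _ => cxExp_clusterExponent _ _

lemma cxExp_totalExponent_of_eq_of_ne (hG : G.IsAcyclic) (lam : ℝ≥0)
    {α β : G.edgeSet → unitInterval} {e : G.edgeSet} (he : α e ≤ β e)
    (hne : ∀ e', e' ≠ e → α e' = β e') :
    CxExp (totalExponent lam α) (totalExponent lam β) := by
  rw [totalExponent, totalExponent,
    sum_openProb_split α e fun q F => clusterExponent F (lam * q),
    sum_openProb_split β e fun q F => clusterExponent F (lam * q)]
  refine CxExp.sum _ fun F hF => ?_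
  rw [openProb_congr (Finset.mem_powerset.1 hF) fun e' he' => hne e' (Finset.ne_of_mem_erase he')]
  have heF : e ∉ F := fun hh => by simpa using Finset.mem_powerset.1 hF hh
  set q := openProb β (Finset.univ.erase e) F
  -- With `δ = β e - α e`, the mass `q * δ` passes from `F` to `insert e F`; the masses `q * (1 - β
  -- e)` on `F` and `q * α e` on `insert e F` stay in place.
  obtain ⟨δ, h1, h2⟩ : ∃ δ : ℝ≥0,
      unitInterval.toNNReal (β e) = δ + unitInterval.toNNReal (α e) ∧
      unitInterval.toNNReal (unitInterval.symm (α e)) =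
        unitInterval.toNNReal (unitInterval.symm (β e)) + δ := by
    obtain ⟨δ, hδ⟩ : ∃ δ : ℝ≥0, (δ : ℝ) = β e - α e := ⟨⟨_, sub_nonneg.2 he⟩, rfl⟩
    refine ⟨δ, NNReal.eq ?_, NNReal.eq ?_⟩
    · simp [hδ]
    · simp [hδ]
  rw [h1, h2, mul_add, mul_add, mul_add, mul_add, clusterExponent_add, clusterExponent_add,
    ← add_assoc]
  exact ((cxExp_clusterExponent _ _).add (cxExp_clusterExponent_insert hG heF _)).add
    (cxExp_clusterExponent _ _)

lemma cxExp_totalExponent_of_le (hG : G.IsAcyclic) (lam : ℝ≥0)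
    {α β : G.edgeSet → unitInterval} (h : ∀ e, α e ≤ β e) :
    CxExp (totalExponent lam α) (totalExponent lam β) := by
  -- Interpolate from `α` to `β`, switching one edge at a time; `T` is the set of edges already
  -- switched.
  have key : ∀ T : Finset G.edgeSet,
      CxExp (totalExponent lam α) (totalExponent lam fun e => if e ∈ T then β e else α e) := by
    intro T
    induction T using Finset.induction_on with
    | empty => simpa using cxExp_totalExponent lam α
    | insert e T he ih =>
      refine ih.trans (cxExp_totalExponent_of_eq_of_ne hG lam (e := e) ?_ fun e' he' => ?_)
      · simpa [he] using h e
      · simp [he']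
  simpa using key Finset.univ

/-! ### The percolation formula for the generating function. -/

/-- The logarithm of the joint probability generating function of `MPMRF(lam, α, G)`. -/
noncomputable def logPGF (lam : ℝ≥0) (α : G.edgeSet → unitInterval) (z : V → ℂ) : ℂ :=
  ∑ F ∈ Finset.univ.powerset,
    ((lam * openProb α Finset.univ F : ℝ≥0) : ℂ) * ∑ C ∈ clusters F, (∏ v ∈ C, z v - 1)

lemma totalExponent_apply (lam : ℝ≥0) (α : G.edgeSet → unitInterval) (t : ℝ) :
    totalExponent lam α t = logPGF lam α fun _ => Complex.exp (t * Complex.I) := by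
  simp only [totalExponent, logPGF, clusterExponent, jumpExponent, Finset.sum_apply,
    Finset.prod_const, Finset.mul_sum]

/-- For each `F` only the cluster of `r` contributes, and the probabilities of the `F` sum to one.
-/
lemma logPGF_of_eq_one (lam : ℝ≥0) (α : G.edgeSet → unitInterval) {z : V → ℂ} {r : V}
    (hz : ∀ v, v ≠ r → z v = 1) : logPGF lam α z = lam * (z r - 1) := by
  have key : ∀ F : Finset G.edgeSet, ∑ C ∈ clusters F, (∏ v ∈ C, z v - 1) = z r - 1 := by
    intro F
    rw [Finset.sum_eq_single_of_mem _ (cluster_mem_clusters F r),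
      Finset.prod_eq_single_of_mem _ (self_mem_cluster F r) fun v _ hv => hz v hv]
    intro C hC hne
    rw [Finset.prod_eq_one, sub_self]
    intro v hv
    refine hz v ?_
    rintro rfl
    exact hne (eq_cluster_of_mem hC hv)
  simp only [logPGF, key]
  rw [← Finset.sum_mul]
  congr 1
  have := congrArg (fun x : ℝ≥0 => ((lam * x : ℝ≥0) : ℂ)) (sum_openProb α Finset.univ)
  simpa [Finset.mul_sum] using this

/-- Summing out a leaf `w` with neighbour `u`. -/
lemma logPGF_leaf (hG : G.IsAcyclic) (lam : ℝ≥0) (α : G.edgeSet → unitInterval) {z : V → ℂ}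
    {u w : V} (h : G.Adj u w)
    (hz : ∀ v ∈ cluster (Finset.univ.erase (⟨s(u, w), h⟩ : G.edgeSet)) w, v ≠ w → z v = 1) :
    logPGF lam α z =
      logPGF lam α (Function.update (Function.update z w 1) u
        (z u * ((1 - (α ⟨s(u, w), h⟩ : ℝ) : ℝ) + ((α ⟨s(u, w), h⟩ : ℝ) : ℂ) * z w))) +
      lam * (1 - (α ⟨s(u, w), h⟩ : ℝ) : ℝ) * (z w - 1) := by
  set e : G.edgeSet := ⟨s(u, w), h⟩ with he
  set q : ℂ := (1 - (α e : ℝ) : ℝ) + ((α e : ℝ) : ℂ) * z w with hq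
  set z' := Function.update (Function.update z w 1) u (z u * q) with hz'
  have hne : u ≠ w := h.ne
  have hz'u : z' u = z u * q := by simp [hz']
  have hz'w : z' w = 1 := by simp [hz', hne.symm]
  have hz'o : ∀ v, v ≠ u → v ≠ w → z' v = z v := fun v h1 h2 => by simp [hz', h1, h2]
  -- The innovation term is spread over the states of the other edges, so that the identity can be
  -- checked for each `F` separately.
  have hfull := congrArg (fun x : ℝ≥0 => ((lam * x : ℝ≥0) : ℂ) *
    ((1 - (α e : ℝ) : ℝ) * (z w - 1))) (sum_openProb α (Finset.univ.erase e))
  simp only [mul_one, Finset.mul_sum, NNReal.coe_sum, Complex.ofReal_sum, Finset.sum_mul] at hfull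
  rw [logPGF, logPGF,
    sum_openProb_split α e fun q F => ((lam * q : ℝ≥0) : ℂ) * ∑ C ∈ clusters F, (∏ v ∈ C, z v - 1),
    sum_openProb_split α e fun q F => ((lam * q : ℝ≥0) : ℂ) * ∑ C ∈ clusters F, (∏ v ∈ C, z' v - 1),
    mul_assoc, ← hfull, ← Finset.sum_add_distrib]
  refine Finset.sum_congr rfl fun F hF => ?_
  have hF := Finset.mem_powerset.1 hF
  have heF : e ∉ F := fun hh => by simpa using hF hh
  have huw := notMem_cluster_of_isAcyclic hG h heF
  obtain ⟨D, hD, hsum⟩ := exists_sum_clusters_insert h huw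
  obtain ⟨h1, h2⟩ := hsum fun C => ∏ v ∈ C, z v - 1
  obtain ⟨h1', h2'⟩ := hsum fun C => ∏ v ∈ C, z' v - 1
  have hDeq : ∑ C ∈ D, (∏ v ∈ C, z' v - 1) = ∑ C ∈ D, (∏ v ∈ C, z v - 1) := by
    refine Finset.sum_congr rfl fun C hC => ?_
    congr 1
    refine Finset.prod_congr rfl fun v hv => hz'o v ?_ ?_
    · rintro rfl; exact (hD C hC).1 hv
    · rintro rfl; exact (hD C hC).2 hv
  -- The vertex `w` need not be a leaf of `G`: `z` is `1` on the rest of its side of `e`, and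
  -- closing more edges only shrinks its cluster.
  have hzF : ∀ v ∈ cluster F w, v ≠ w → z v = 1 := fun v hv =>
    hz v (mem_cluster.2 ((mem_cluster.1 hv).mono (openGraph_mono hF)))
  have hw : ∏ v ∈ cluster F w, z v = z w :=
    Finset.prod_eq_single_of_mem _ (self_mem_cluster F w) hzF
  have hwu : u ∉ cluster F w := fun hh => huw (mem_cluster.2 (mem_cluster.1 hh).symm)
  have hw' : ∏ v ∈ cluster F w, z' v = 1 := by
    refine Finset.prod_eq_one fun v hv => ?_
    by_cases hvw : v = w
    · rw [hvw, hz'w]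
    · rw [hz'o v (fun hh => hwu (hh ▸ hv)) hvw, hzF v hv hvw]
  have hu' : ∏ v ∈ cluster F u, z' v = (∏ v ∈ cluster F u, z v) * q := by
    rw [← Finset.mul_prod_erase _ _ (self_mem_cluster F u),
      ← Finset.mul_prod_erase (cluster F u) z (self_mem_cluster F u), hz'u,
      Finset.prod_congr rfl fun v hv => hz'o v (Finset.ne_of_mem_erase hv) ?_]
    · ring
    · rintro rfl; exact huw (Finset.mem_of_mem_erase hv)
  simp only [Finset.prod_union (disjoint_cluster huw), hw, hw', hu', hDeq] at h1 h2 h1' h2'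
  rw [h1, h2, h1', h2', hq]
  push_cast
  simp only [unitInterval.coe_toNNReal, unitInterval.coe_symm_eq]
  push_cast
  ring

end Percolation

/-! ### Parents and distances in the rooted tree. -/

section RootedTree

variable {V : Type*} {G : SimpleGraph V}

lemma exists_isParent (hG : G.Connected) {r v : V} (hv : v ≠ r) : ∃ u, IsParent G r u v := by
  obtain ⟨p, hp⟩ := hG.exists_walk_length_eq_dist v r
  cases p with
  | nil => exact absurd rfl hv
  | @cons _ u _ h q =>
    refine ⟨u, h.symm, ?_⟩
    rw [SimpleGraph.Walk.length_cons] at hp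
    have h1 := SimpleGraph.dist_le q
    have h2 := hG.dist_triangle (u := v) (v := u) (w := r)
    rw [SimpleGraph.dist_eq_one_iff_adj.2 h] at h2
    rw [G.dist_comm (u := r) (v := v), G.dist_comm (u := r) (v := u)]
    omega

/-- When the edge above `w` is removed, all the other vertices in the component of `w` are farther
from the root than `w`. -/
lemma dist_lt_of_mem_cluster [Fintype V] [DecidableEq G.edgeSet] [Fintype G.edgeSet]
    (hG : G.IsTree) {r u w : V}
    (h : IsParent G r u w) {v : V}
    (hv : v ∈ cluster (Finset.univ.erase (⟨s(u, w), h.1⟩ : G.edgeSet)) w) (hvw : v ≠ w) :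
    G.dist r w < G.dist r v := by
  classical
  by_contra! hlt
  -- A geodesic from `r` to such an `x` cannot pass through `w`, hence does not use the edge above
  -- `w`. Applied to `u` and to `v`, this would connect `w` to `u` without that bridge.
  have avoid : ∀ x, x ≠ w → G.dist r x ≤ G.dist r w →
      (openGraph (Finset.univ.erase (⟨s(u, w), h.1⟩ : G.edgeSet))).Reachable r x := by
    intro x hxw hx
    obtain ⟨p, hp⟩ := hG.connected.exists_walk_length_eq_dist r x
    refine ⟨p.transfer _ fun e he => ?_⟩
    have heG := p.edges_subset_edgeSet he
    induction e with | _ a b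
    refine ⟨⟨s(a, b), heG⟩, Finset.mem_erase.2 ⟨fun hh => ?_, Finset.mem_univ _⟩, rfl⟩
    rw [show s(a, b) = s(u, w) from congrArg Subtype.val hh] at he
    have hs := p.snd_mem_support_of_mem_edges he
    have hl := congrArg SimpleGraph.Walk.length (p.take_spec hs)
    rw [SimpleGraph.Walk.length_append] at hl
    have h1 := SimpleGraph.dist_le (p.takeUntil w hs)
    have h2 := SimpleGraph.dist_le (p.dropUntil w hs)
    have h3 := hG.connected.pos_dist_of_ne hxw.symm
    omega
  have hu := avoid u h.1.ne (by have := h.2; omega)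
  have hv' := avoid v hvw hlt
  refine notMem_cluster_of_isAcyclic hG.isAcyclic h.1 (Finset.notMem_erase _ _) (mem_cluster.2
    ((hu.symm.trans hv').trans ?_))
  exact (mem_cluster.1 hv).symm

end RootedTree

/-! ### Generating functions of thinnings and Poisson laws. -/

lemma measurable_thin : Measurable fun p : (ℕ → ℕ) × ℕ => thin p.1 p.2 := by
  refine measurable_from_prod_countable_left fun k => ?_
  simp only [thin]
  fun_prop

lemma norm_pow_le_one {z : ℂ} (hz : ‖z‖ ≤ 1) (n : ℕ) : ‖z ^ n‖ ≤ 1 := by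
  rw [norm_pow]
  exact pow_le_one₀ (norm_nonneg z) hz

lemma integral_pow_poissonMeasure (s : ℝ≥0) (z : ℂ) :
    ∫ n, z ^ n ∂(poissonMeasure s) = Complex.exp (s * (z - 1)) := by
  rw [integral_poissonMeasure s]
  calc ∑' a : ℕ, (Real.exp (-s) * s ^ a / a.factorial : ℝ) • z ^ a
      = ∑' a : ℕ, (Real.exp (-s) : ℂ) * ((s * z) ^ a / a.factorial) := by
        congr with a
        rw [Complex.real_smul]
        push_cast
        rw [mul_pow]
        ring
    _ = (Real.exp (-s) : ℂ) * ∑' a : ℕ, ((s * z) ^ a / a.factorial) := tsum_mul_left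
    _ = (Real.exp (-s) : ℂ) * Complex.exp (s * z) := by
        rw [(NormedSpace.expSeries_div_hasSum_exp (s * z)).tsum_eq, Complex.exp_eq_exp_ℂ]
    _ = Complex.exp (s * (z - 1)) := by
        rw [Complex.ofReal_exp, ← Complex.exp_add]
        push_cast
        ring_nf

section Independence

variable {Ω : Type*} [MeasurableSpace Ω] {P : Measure Ω}

/-- Freezing the first of two independent variables. -/
lemma integral_of_indepFun [IsProbabilityMeasure P] {𝓧 𝓨 : Type*} [MeasurableSpace 𝓧]
    [MeasurableSpace 𝓨] {X : Ω → 𝓧} {Y : Ω → 𝓨} (hX : Measurable X) (hY : Measurable Y) (hXY : IndepFun X Y P)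
    {h : 𝓧 × 𝓨 → ℂ} (hh : Measurable h) (hb : ∀ ω, ‖h (X ω, Y ω)‖ ≤ 1) {H : 𝓧 → ℂ}
    (hHm : Measurable H) (hH : ∀ x, ∫ ω, h (x, Y ω) ∂P = H x) :
    ∫ ω, h (X ω, Y ω) ∂P = ∫ ω, H (X ω) ∂P := by
  have hmap := (indepFun_iff_map_prod_eq_prod_map_map hX.aemeasurable hY.aemeasurable).1 hXY
  have := Measure.isProbabilityMeasure_map (μ := P) hX.aemeasurable
  have := Measure.isProbabilityMeasure_map (μ := P) hY.aemeasurable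
  have hint : Integrable h ((P.map X).prod (P.map Y)) := by
    rw [← hmap, integrable_map_measure hh.aestronglyMeasurable (by fun_prop)]
    exact (integrable_const (1 : ℝ)).mono (hh.comp (hX.prodMk hY)).aestronglyMeasurable
      (Filter.Eventually.of_forall fun ω => by
      simpa using hb ω)
  rw [← integral_map (φ := fun ω => (X ω, Y ω)) (by fun_prop) hh.aestronglyMeasurable, hmap,
    integral_prod _ hint, ← integral_map hX.aemeasurable hHm.aestronglyMeasurable]
  refine integral_congr_ae (Filter.Eventually.of_forall fun x => ?_)
  rw [← hH x]
  exact integral_map hY.aemeasurable (hh.comp measurable_prodMk_left).aestronglyMeasurable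

/-- For fixed `k` only finitely many variables occur: `none` indexes the innovation and `some n` the
indicators, and independence factors the integral. -/
lemma integral_pow_thin {ι : Type*} {Z : ι → Ω → ℕ} (hZ : iIndepFun Z P)
    (hm : ∀ i, Measurable (Z i)) {i₀ : ι} {j : ℕ → ι} (hj : j.Injective) (hi : ∀ n, j n ≠ i₀)
    {p : unitInterval} (hp : ∀ n, HasLaw (Z (j n)) (bernoulliMeasure 1 0 p) P) {s : ℝ≥0}
    (hs : HasLaw (Z i₀) (poissonMeasure s) P) (z : ℂ) (k : ℕ) :
    ∫ ω, z ^ thin (fun n => Z (j n) ω) k * z ^ Z i₀ ω ∂P =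
      ((1 - (p : ℝ) : ℝ) + ((p : ℝ) : ℂ) * z) ^ k * Complex.exp (s * (z - 1)) := by
  let g : Option (Fin k) → ι := fun o => o.elim i₀ fun n => j n
  have hg : g.Injective := by
    rintro (_ | a) (_ | b) hab
    · rfl
    · exact absurd hab.symm (hi b)
    · exact absurd hab (hi a)
    · exact congrArg some (Fin.ext (hj hab))
  have hprod := (hZ.precomp hg).integral_fun_prod_comp (f := fun _ n => z ^ n)
    (fun i => (hm _).aemeasurable) (fun i => .of_discrete)
  rw [Fintype.prod_option] at hprod
  have h0 : ∫ ω, z ^ Z (g none) ω ∂P = Complex.exp (s * (z - 1)) := by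
    rw [← integral_pow_poissonMeasure]
    exact hs.integral_comp (f := fun n => z ^ n) .of_discrete
  have h1 : ∀ n : Fin k, ∫ ω, z ^ Z (g (some n)) ω ∂P = (1 - (p : ℝ) : ℝ) + ((p : ℝ) : ℂ) * z := by
    intro n
    have := (hp n).integral_comp (f := fun n => z ^ n) .of_discrete
    rw [integral_bernoulliMeasure] at this
    refine this.trans ?_
    simp only [pow_one, pow_zero, Complex.real_smul, mul_one]
    ring
  simp only [h0, h1, Finset.prod_const, Finset.card_univ, Fintype.card_fin] at hprod
  rw [mul_comm (Complex.exp _)] at hprod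
  rw [← hprod]
  refine integral_congr_ae (Filter.Eventually.of_forall fun ω => ?_)
  simp only [Fintype.prod_option, thin]
  rw [mul_comm, Finset.prod_pow_eq_pow_sum, ← Fin.sum_univ_eq_sum_range (fun n => Z (j n) ω)]
  rfl

end Independence

/-! ### A measurable version of the construction. -/

/-- The stochastic construction with measurable innovations and indicators, and a choice `pa v` of
the parent of each vertex `v ≠ r`. -/
structure IsMeasurableConstruction {V : Type*} (G : SimpleGraph V) (r : V) (lam : ℝ≥0)
    (α : G.edgeSet → unitInterval) (pa : V → V) {Ω : Type*} [MeasurableSpace Ω] (P : Measure Ω)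
    (L : V → Ω → ℕ) (I : G.edgeSet → ℕ → Ω → ℕ) (N : V → Ω → ℕ) : Prop where
  isParent : ∀ v, v ≠ r → IsParent G r (pa v) v
  measurable_innovation : ∀ v, Measurable (L v)
  measurable_indicator : ∀ e i, Measurable (I e i)
  indep : iIndepFun
    (Sum.elim L (fun p : G.edgeSet × ℕ => I p.1 p.2) : V ⊕ (G.edgeSet × ℕ) → Ω → ℕ) P
  law_indicator : ∀ e i, HasLaw (I e i) (bernoulliMeasure 1 0 (α e)) P
  law_root : HasLaw (L r) (poissonMeasure lam) P
  law_child : ∀ v (hv : v ≠ r), HasLaw (L v) (poissonMeasure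
    (lam * unitInterval.toNNReal (unitInterval.symm (α ⟨s(pa v, v), (isParent v hv).1⟩)))) P
  eq_root : ∀ ω, N r ω = L r ω
  eq_child : ∀ v (hv : v ≠ r) ω,
    N v ω = thin (fun i => I ⟨s(pa v, v), (isParent v hv).1⟩ i ω) (N (pa v) ω) + L v ω

section Recursion

variable {V : Type*} {G : SimpleGraph V} {r : V} {pa : V → V}

open scoped Classical in
/-- The value of the recursive construction at the vertices at distance at most `n` from the
root. -/
noncomputable def recursiveValue (hpa : ∀ v, v ≠ r → IsParent G r (pa v) v) (L : V → ℕ)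
    (I : G.edgeSet → ℕ → ℕ) : ℕ → V → ℕ
  | 0, v => L v
  | n + 1, v => if hv : v = r then L v else
      thin (I ⟨s(pa v, v), (hpa v hv).1⟩) (recursiveValue hpa L I n (pa v)) + L v

lemma recursiveValue_root (hpa : ∀ v, v ≠ r → IsParent G r (pa v) v) (L : V → ℕ)
    (I : G.edgeSet → ℕ → ℕ) (n : ℕ) : recursiveValue hpa L I n r = L r := by
  cases n <;> simp [recursiveValue]

lemma recursiveValue_eq (hG : G.Connected) (hpa : ∀ v, v ≠ r → IsParent G r (pa v) v) {L : V → ℕ}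
    {I : G.edgeSet → ℕ → ℕ} {N : V → ℕ} (h0 : N r = L r)
    (h1 : ∀ v (hv : v ≠ r), N v = thin (I ⟨s(pa v, v), (hpa v hv).1⟩) (N (pa v)) + L v) (n : ℕ) :
    ∀ v, G.dist r v ≤ n → recursiveValue hpa L I n v = N v := by
  induction n with
  | zero =>
    intro v hv
    obtain rfl := hG.dist_eq_zero_iff.1 (Nat.le_zero.1 hv)
    exact h0.symm
  | succ n ih =>
    intro v hv
    by_cases hvr : v = r
    · rw [hvr, recursiveValue_root, h0]
    · rw [recursiveValue, dif_neg hvr, h1 v hvr, ih _ (by have := (hpa v hvr).2; omega)]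

lemma recursiveValue_dist (hpa : ∀ v, v ≠ r → IsParent G r (pa v) v) (L : V → ℕ)
    (I : G.edgeSet → ℕ → ℕ) {v : V} (hv : v ≠ r) :
    recursiveValue hpa L I (G.dist r v) v = thin (I ⟨s(pa v, v), (hpa v hv).1⟩)
      (recursiveValue hpa L I (G.dist r (pa v)) (pa v)) + L v := by
  have : recursiveValue hpa L I (G.dist r (pa v) + 1) v = thin (I ⟨s(pa v, v), (hpa v hv).1⟩)
      (recursiveValue hpa L I (G.dist r (pa v)) (pa v)) + L v := by
    rw [recursiveValue, dif_neg hv]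
  exact (congrArg (fun n => recursiveValue hpa L I n v) (hpa v hv).2).trans this

end Recursion

/-- `HasLaw` only provides a.e. measurability. Replacing the inputs by measurable versions would
break the recursion on a null set, so `N'` is rebuilt from them and the recursion holds at every
`ω`. -/
lemma IsConstruction.exists_isMeasurableConstruction {V : Type*} [Finite V] {G : SimpleGraph V}
    (hG : G.Connected) {r : V} {lam : ℝ≥0} {α : G.edgeSet → unitInterval} {Ω : Type*}
    [MeasurableSpace Ω] {P : Measure Ω} {L : V → Ω → ℕ} {I : G.edgeSet → ℕ → Ω → ℕ}
    {N : V → Ω → ℕ} (h : IsConstruction G r lam α P L I N) :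
    ∃ pa L' I' N', IsMeasurableConstruction G r lam α pa P L' I' N' ∧
      ∀ᵐ ω ∂P, ∀ v, N v ω = N' v ω := by
  classical
  have hex : ∀ v, ∃ u, v ≠ r → IsParent G r u v := fun v => by
    by_cases hv : v = r
    · exact ⟨v, fun hh => absurd hv hh⟩
    · obtain ⟨u, hu⟩ := exists_isParent hG hv
      exact ⟨u, fun _ => hu⟩
  choose pa hpa using hex
  have hLm : ∀ v, AEMeasurable (L v) P := fun v => by
    by_cases hv : v = r
    · rw [hv]; exact h.law_root.aemeasurable
    · exact (h.law_child _ v (hpa v hv)).aemeasurable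
  have hIm : ∀ e i, AEMeasurable (I e i) P := fun e i => (h.law_indicator e i).aemeasurable
  let L' : V → Ω → ℕ := fun v => (hLm v).mk (L v)
  let I' : G.edgeSet → ℕ → Ω → ℕ := fun e i => (hIm e i).mk (I e i)
  have hL' : ∀ v, L v =ᵐ[P] L' v := fun v => (hLm v).ae_eq_mk
  have hI' : ∀ e i, I e i =ᵐ[P] I' e i := fun e i => (hIm e i).ae_eq_mk
  refine ⟨pa, L', I', fun v ω => recursiveValue hpa (fun v => L' v ω) (fun e i => I' e i ω)
    (G.dist r v) v, ⟨hpa, fun v => (hLm v).measurable_mk, fun e i => (hIm e i).measurable_mk,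
    ?_, fun e i => (h.law_indicator e i).congr (hI' e i).symm, h.law_root.congr (hL' r).symm,
    fun v hv => (h.law_child _ v (hpa v hv)).congr (hL' v).symm,
    fun ω => recursiveValue_root hpa _ _ _, fun v hv ω => recursiveValue_dist hpa _ _ hv⟩, ?_⟩
  · refine h.indep.congr ?_
    rintro (v | ⟨e, i⟩)
    · exact hL' v
    · exact hI' e i
  · have h1 : ∀ᵐ ω ∂P, ∀ v, L v ω = L' v ω := ae_all_iff.2 hL'
    have h2 : ∀ᵐ ω ∂P, ∀ e i, I e i ω = I' e i ω :=
      ae_all_iff.2 fun e => ae_all_iff.2 fun i => hI' e i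
    filter_upwards [h1, h2] with ω h1 h2 v
    simp only [← h1, ← h2]
    exact (recursiveValue_eq hG hpa (N := fun v => N v ω) (h.eq_root ω)
      (fun v hv => h.eq_child _ v (hpa v hv) ω) _ v le_rfl).symm

/-! ### The joint generating function, by peeling off farthest vertices. -/

namespace IsMeasurableConstruction

variable {V : Type*} {G : SimpleGraph V} {r : V} {lam : ℝ≥0} {α : G.edgeSet → unitInterval}
  {pa : V → V} {Ω : Type*}

lemma dist_induction {p : V → Prop} (hpa : ∀ v, v ≠ r → IsParent G r (pa v) v) (h0 : p r)
    (h1 : ∀ v, v ≠ r → p (pa v) → p v) (v : V) : p v := by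
  induction hn : G.dist r v using Nat.strong_induction_on generalizing v with
  | _ n ih =>
    by_cases hv : v = r
    · exact hv ▸ h0
    · exact h1 v hv (ih _ (by have := (hpa v hv).2; omega) _ rfl)

/-- Ancestors of `v` are strictly closer to the root than `v`, so `w` is never among them and its
inputs are not used. The σ-algebra is arbitrary, to allow the one generated by the other inputs. -/
lemma measurable_of_dist_le {m : MeasurableSpace Ω} {L : V → Ω → ℕ} {I : G.edgeSet → ℕ → Ω → ℕ}
    {N : V → Ω → ℕ} (hpa : ∀ v, v ≠ r → IsParent G r (pa v) v)
    (h0 : ∀ ω, N r ω = L r ω) (h1 : ∀ v (hv : v ≠ r) ω,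
      N v ω = thin (fun i => I ⟨s(pa v, v), (hpa v hv).1⟩ i ω) (N (pa v) ω) + L v ω)
    {w : V} (hL : ∀ v, v ≠ w → Measurable (L v))
    (hI : ∀ v (hv : v ≠ r), v ≠ w → G.dist r v ≤ G.dist r w →
      ∀ i, Measurable (I ⟨s(pa v, v), (hpa v hv).1⟩ i)) (v : V) :
    v ≠ w → G.dist r v ≤ G.dist r w → Measurable (N v) := by
  refine dist_induction (p := fun v => v ≠ w → G.dist r v ≤ G.dist r w → Measurable (N v)) hpa
    ?_ ?_ v
  · intro hr _
    rw [funext h0]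
    exact hL r hr
  · intro v hv ih hvw hd
    have hd' := (hpa v hv).2
    rw [funext (h1 v hv)]
    refine (measurable_thin.comp ((measurable_pi_lambda _ fun i => hI v hv hvw hd i).prodMk
      (ih ?_ (by omega)))).add (hL v hvw)
    intro hh
    rw [hh] at hd'
    omega

variable [MeasurableSpace Ω] {P : Measure Ω} {L : V → Ω → ℕ} {I : G.edgeSet → ℕ → Ω → ℕ}
  {N : V → Ω → ℕ}

lemma measurable (h : IsMeasurableConstruction G r lam α pa P L I N) (v : V) :
    Measurable (N v) := by
  refine dist_induction (p := fun v => Measurable (N v)) h.isParent ?_ ?_ v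
  · rw [funext h.eq_root]
    exact h.measurable_innovation r
  · intro v hv ih
    rw [funext (h.eq_child v hv)]
    exact (measurable_thin.comp ((measurable_pi_lambda _ fun i => h.measurable_indicator _ i).prodMk
      ih)).add (h.measurable_innovation v)

/-- The vertices other than `w` that are not farther from the root are independent of the variables
that are used at `w` only. -/
lemma indepFun (h : IsMeasurableConstruction G r lam α pa P L I N) {w : V} (hw : w ≠ r)
    {𝓧 : Type*} [MeasurableSpace 𝓧] {X : Ω → 𝓧}
    (hX : ∀ m : MeasurableSpace Ω, (∀ v, v ≠ w → G.dist r v ≤ G.dist r w → Measurable[m] (N v)) →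
      Measurable[m] X) :
    IndepFun X (fun ω => (fun i => I ⟨s(pa w, w), (h.isParent w hw).1⟩ i ω, L w ω)) P := by
  set e : G.edgeSet := ⟨s(pa w, w), (h.isParent w hw).1⟩ with he
  set Z : V ⊕ (G.edgeSet × ℕ) → Ω → ℕ := Sum.elim L (fun p : G.edgeSet × ℕ => I p.1 p.2) with hZ
  have hZm : ∀ i, Measurable (Z i) := by
    rintro (v | ⟨e, i⟩)
    · exact h.measurable_innovation v
    · exact h.measurable_indicator e i
  let B : Set (V ⊕ (G.edgeSet × ℕ)) := insert (Sum.inl w) (Set.range fun i => Sum.inr (e, i))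
  have hind := indep_iSup_of_disjoint (fun i => (hZm i).comap_le) h.indep
    (disjoint_compl_left (a := B))
  have hmeas : ∀ (A : Set (V ⊕ (G.edgeSet × ℕ))) i, i ∈ A →
      Measurable[⨆ i ∈ A, MeasurableSpace.comap (Z i) inferInstance] (Z i) := fun A i hi =>
    Measurable.of_comap_le (le_iSup₂_of_le i hi le_rfl)
  have hYgen : ∀ m : MeasurableSpace Ω, (∀ i, Measurable[m] (I e i)) → Measurable[m] (L w) →
      Measurable[m] fun ω => (fun i => I e i ω, L w ω) := fun m h1 h2 =>
    Measurable.prodMk (measurable_pi_lambda _ h1) h2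
  rw [IndepFun_iff_Indep]
  refine indep_of_indep_of_le_left (indep_of_indep_of_le_right hind ?_) ?_
  · exact Measurable.comap_le (hYgen _
      (fun i => hmeas B (Sum.inr (e, i)) (Set.mem_insert_of_mem _ ⟨i, rfl⟩))
      (hmeas B (Sum.inl w) (Set.mem_insert _ _)))
  · refine Measurable.comap_le (hX _ fun v hvw hd => ?_)
    refine measurable_of_dist_le (L := L) (I := I) h.isParent h.eq_root h.eq_child (w := w) ?_ ?_
      v hvw hd
    · intro v hv
      refine hmeas Bᶜ (Sum.inl v) ?_
      rintro (hh | ⟨i, hh⟩)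
      · exact hv (Sum.inl_injective hh)
      · exact Sum.inr_ne_inl hh
    · intro v hv hvw hd i
      refine hmeas Bᶜ (Sum.inr (⟨s(pa v, v), (h.isParent v hv).1⟩, i)) ?_
      rintro (hh | ⟨i, hh⟩)
      · exact Sum.inr_ne_inl hh
      · have h1 := congrArg (fun p => p.1.1) (Sum.inr_injective hh)
        have hdv := (h.isParent v hv).2
        have hdw := (h.isParent w hw).2
        rcases Sym2.eq_iff.1 h1 with ⟨-, h2⟩ | ⟨h2, h3⟩
        · exact hvw h2.symm
        · rw [← h3] at hdv
          rw [h2] at hdw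
          omega

variable [Fintype V] [IsProbabilityMeasure P]

open scoped Classical in
/-- The expectation over the variables at a vertex `w` beyond which `z` is `1`. -/
lemma integral_prod_pow_peel (h : IsMeasurableConstruction G r lam α pa P L I N) {z : V → ℂ}
    (hz : ∀ v, ‖z v‖ ≤ 1) {w : V} (hw : w ≠ r) (hz1 : ∀ v, G.dist r w < G.dist r v → z v = 1) :
    ∫ ω, ∏ v, z v ^ N v ω ∂P =
      (∫ ω, ∏ v, (Function.update (Function.update z w 1) (pa w) (z (pa w) *
        ((1 - (α ⟨s(pa w, w), (h.isParent w hw).1⟩ : ℝ) : ℝ) +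
          ((α ⟨s(pa w, w), (h.isParent w hw).1⟩ : ℝ) : ℂ) * z w))) v ^ N v ω ∂P) *
      Complex.exp (lam * (1 - (α ⟨s(pa w, w), (h.isParent w hw).1⟩ : ℝ) : ℝ) * (z w - 1)) := by
  set e : G.edgeSet := ⟨s(pa w, w), (h.isParent w hw).1⟩ with he
  set q : ℂ := (1 - (α e : ℝ) : ℝ) + ((α e : ℝ) : ℂ) * z w with hq
  set c : ℂ := Complex.exp (lam * (1 - (α e : ℝ) : ℝ) * (z w - 1)) with hc
  have hne : pa w ≠ w := (h.isParent w hw).1.ne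
  have hdw := (h.isParent w hw).2
  let X : Ω → ℂ × ℕ := fun ω => (∏ v ∈ Finset.univ.erase w, z v ^ N v ω, N (pa w) ω)
  let Y : Ω → (ℕ → ℕ) × ℕ := fun ω => (fun i => I e i ω, L w ω)
  let g : (ℂ × ℕ) × ((ℕ → ℕ) × ℕ) → ℂ :=
    fun p => p.1.1 * (z w ^ thin p.2.1 p.1.2 * z w ^ p.2.2)
  have hXgen : ∀ m : MeasurableSpace Ω,
      (∀ v, v ≠ w → G.dist r v ≤ G.dist r w → Measurable[m] (N v)) → Measurable[m] X := by
    intro m hm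
    -- Vertices farther than `w` may depend on the inputs at `w`, but their factors are identically
    -- `1`.
    refine Measurable.prodMk (Finset.measurable_prod _ fun v hv => ?_) (hm _ hne (by omega))
    by_cases hd : G.dist r v ≤ G.dist r w
    · exact (measurable_from_nat (f := fun n => z v ^ n)).comp (hm v (Finset.ne_of_mem_erase hv) hd)
    · simp only [hz1 v (not_le.1 hd), one_pow]
      exact measurable_const
  have hX : Measurable X := hXgen _ fun v _ _ => h.measurable v
  have hY : Measurable Y := (measurable_pi_lambda _ fun i => h.measurable_indicator e i).prodMk
    (h.measurable_innovation w)
  have hg : Measurable g := by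
    have h1 : Measurable fun p : (ℂ × ℕ) × ((ℕ → ℕ) × ℕ) => thin p.2.1 p.1.2 :=
      measurable_thin.comp (measurable_snd.fst.prodMk measurable_fst.snd)
    exact measurable_fst.fst.mul (((measurable_from_nat (f := fun n => z w ^ n)).comp h1).mul
      ((measurable_from_nat (f := fun n => z w ^ n)).comp measurable_snd.snd))
  have hgXY : ∀ ω, g (X ω, Y ω) = ∏ v, z v ^ N v ω := by
    intro ω
    rw [← Finset.prod_erase_mul _ _ (Finset.mem_univ w), h.eq_child w hw ω, pow_add]
  have hb : ∀ ω, ‖g (X ω, Y ω)‖ ≤ 1 := by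
    intro ω
    rw [hgXY, norm_prod]
    exact Finset.prod_le_one (fun v _ => norm_nonneg _) fun v _ => norm_pow_le_one (hz v) _
  have hHm : Measurable fun x : ℂ × ℕ => x.1 * (q ^ x.2 * c) :=
    measurable_fst.mul (((measurable_from_nat (f := fun n => q ^ n)).comp measurable_snd).mul
      measurable_const)
  have hH : ∀ x : ℂ × ℕ, ∫ ω, g (x, Y ω) ∂P = x.1 * (q ^ x.2 * c) := by
    rintro ⟨a, k⟩
    have hZm : ∀ i, Measurable ((Sum.elim L (fun p : G.edgeSet × ℕ => I p.1 p.2) :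
        V ⊕ (G.edgeSet × ℕ) → Ω → ℕ) i) := by
      rintro (v | ⟨e, i⟩)
      · exact h.measurable_innovation v
      · exact h.measurable_indicator e i
    have := integral_pow_thin h.indep hZm (i₀ := Sum.inl w) (j := fun i => Sum.inr (e, i))
      (fun a b hab => by simpa using hab) (fun n => Sum.inr_ne_inl) (h.law_indicator e)
      (h.law_child w hw) (z w) k
    simp only [g, Y]
    rw [integral_const_mul]
    refine congrArg (a * ·) (this.trans ?_)
    simp [q, c, e]
  have key := integral_of_indepFun hX hY (h.indepFun hw hXgen) hg hb hHm hH
  simp only [hgXY] at key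
  rw [key, ← integral_mul_const]
  refine integral_congr_ae (Filter.Eventually.of_forall fun ω => ?_)
  simp only [X]
  rw [← mul_assoc]
  congr 1
  have hmem : pa w ∈ Finset.univ.erase w := Finset.mem_erase.2 ⟨hne, Finset.mem_univ _⟩
  rw [← Finset.prod_erase_mul _ _ (Finset.mem_univ w), ← Finset.prod_erase_mul _ _ hmem,
    ← Finset.prod_erase_mul (Finset.univ.erase w) _ hmem, Function.update_self,
    Function.update_of_ne hne.symm, Function.update_self, one_pow, mul_one, mul_pow, ← mul_assoc]
  congr 2
  refine Finset.prod_congr rfl fun v hv => ?_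
  rw [Function.update_of_ne (Finset.ne_of_mem_erase hv),
    Function.update_of_ne (Finset.ne_of_mem_erase (Finset.mem_of_mem_erase hv))]

/-- The joint probability generating function. -/
theorem integral_prod_pow (h : IsMeasurableConstruction G r lam α pa P L I N) (hG : G.IsTree)
    {z : V → ℂ} (hz : ∀ v, ‖z v‖ ≤ 1) :
    ∫ ω, ∏ v, z v ^ N v ω ∂P = Complex.exp (logPGF lam α z) := by
  classical
  -- Induction on a set `S` that, together with `r`, is closed under parents and outside which `z`
  -- is `1`. Removing a farthest vertex of `S` keeps it closed, and the update of `z` changes only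
  -- that vertex and its parent.
  have key : ∀ (n : ℕ) (S : Finset V), S.card = n → r ∉ S → (∀ v ∈ S, pa v ∈ S ∨ pa v = r) →
      ∀ z : V → ℂ, (∀ v, ‖z v‖ ≤ 1) → (∀ v, v ∉ S → v ≠ r → z v = 1) →
      ∫ ω, ∏ v, z v ^ N v ω ∂P = Complex.exp (logPGF lam α z) := by
    intro n
    induction n with
    | zero =>
      intro S hS _ _ z hz hzS
      obtain rfl := Finset.card_eq_zero.1 hS
      have hz1 : ∀ v, v ≠ r → z v = 1 := fun v hv => hzS v (by simp) hv
      rw [logPGF_of_eq_one lam α hz1, ← integral_pow_poissonMeasure]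
      refine Eq.trans ?_ (h.law_root.integral_comp (f := fun n => z r ^ n) .of_discrete)
      refine integral_congr_ae (Filter.Eventually.of_forall fun ω => ?_)
      simp only [Function.comp]
      rw [Finset.prod_eq_single_of_mem r (Finset.mem_univ r) fun v _ hv => by
        rw [hz1 v hv, one_pow], h.eq_root]
    | succ n ih =>
      intro S hS hr hcl z hz hzS
      obtain ⟨w, hwS, hmax⟩ := Finset.exists_max_image S (G.dist r)
        (Finset.card_pos.1 (by omega))
      have hw : w ≠ r := fun hh => hr (hh ▸ hwS)
      have hpar := h.isParent w hw
      have hz1 : ∀ v, G.dist r w < G.dist r v → z v = 1 := by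
        intro v hv
        refine hzS v (fun hh => (hmax v hh).not_gt hv) ?_
        rintro rfl
        simp at hv
      rw [h.integral_prod_pow_peel hz hw hz1, logPGF_leaf hG.isAcyclic lam α hpar.1
        fun v hv hvw => hz1 v (dist_lt_of_mem_cluster hG hpar hv hvw), Complex.exp_add]
      congr 1
      refine ih (S.erase w) (by rw [Finset.card_erase_of_mem hwS, hS]; rfl)
        (fun hh => hr (Finset.mem_of_mem_erase hh)) ?_ _ ?_ ?_
      · intro v hv
        have hvS := Finset.mem_of_mem_erase hv
        refine (hcl v hvS).imp_left fun hp => Finset.mem_erase.2 ⟨fun hh => ?_, hp⟩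
        have h1 := hmax v hvS
        have h2 := (h.isParent v fun hh => hr (hh ▸ hvS)).2
        rw [hh] at h2
        omega
      · intro v
        by_cases hv : v = pa w
        · rw [hv, Function.update_self, norm_mul]
          -- The new factor is a convex combination of `1` and `z w`, so the unit disc is preserved.
          refine mul_le_one₀ (hz _) (norm_nonneg _) ((norm_add_le _ _).trans ?_)
          set e : G.edgeSet := ⟨s(pa w, w), hpar.1⟩
          have h0 := (α e).2.1
          have h1 := (α e).2.2
          rw [norm_mul, Complex.norm_real, Complex.norm_real, Real.norm_of_nonneg h0,
            Real.norm_of_nonneg (sub_nonneg.2 h1)]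
          nlinarith [hz w, mul_le_mul_of_nonneg_left (hz w) h0]
        · rw [Function.update_of_ne hv]
          by_cases hvw : v = w
          · simp [hvw]
          · rw [Function.update_of_ne hvw]
            exact hz v
      · intro v hv hvr
        have hvp : v ≠ pa w := by
          rintro rfl
          rcases hcl w hwS with hp | hp
          · exact hv (Finset.mem_erase.2 ⟨hpar.1.ne, hp⟩)
          · exact hvr hp
        rw [Function.update_of_ne hvp]
        by_cases hvw : v = w
        · simp [hvw]
        · rw [Function.update_of_ne hvw]
          exact hzS v (fun hh => hv (Finset.mem_erase.2 ⟨hvw, hh⟩)) hvr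
  refine key _ (Finset.univ.erase r) rfl (Finset.notMem_erase _ _) (fun v _ => ?_) z hz
    fun v hv hvr => absurd (Finset.mem_erase.2 ⟨hvr, Finset.mem_univ v⟩) hv
  by_cases hp : pa v = r
  · exact Or.inr hp
  · exact Or.inl (Finset.mem_erase.2 ⟨hp, Finset.mem_univ _⟩)

end IsMeasurableConstruction

/-! ### The characteristic function of the total. -/

lemma IsMPMRF.aemeasurable {V : Type*} [Fintype V] {G : SimpleGraph V} {lam : ℝ≥0}
    {α : G.edgeSet → unitInterval} {Ω : Type*} [MeasurableSpace Ω] {P : Measure Ω}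
    {N : V → Ω → ℕ} (h : IsMPMRF G lam α P N) :
    AEMeasurable (fun ω => ((∑ v, N v ω : ℕ) : ℝ)) P := by
  obtain ⟨r, Ω₀, _, P₀, L, I, N₀, _, -, hid⟩ := h
  exact (Measurable.of_discrete (f := fun x : V → ℕ => ((∑ v, x v : ℕ) : ℝ))).comp_aemeasurable
    hid.aemeasurable_fst

/-- Evaluate the joint generating function at `exp (t * I)` in every coordinate; the resulting
exponent is the same for every choice of root. -/
lemma IsMPMRF.charFun_eq {V : Type*} [Fintype V] {G : SimpleGraph V} (hG : G.IsTree) {lam : ℝ≥0}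
    {α : G.edgeSet → unitInterval} {Ω : Type*} [MeasurableSpace Ω] {P : Measure Ω}
    {N : V → Ω → ℕ} (h : IsMPMRF G lam α P N) (t : ℝ) :
    charFun (P.map fun ω => ((∑ v, N v ω : ℕ) : ℝ)) t = Complex.exp (totalExponent lam α t) := by
  have hm := h.aemeasurable
  obtain ⟨r, Ω₀, _, P₀, L, I, N₀, _, hc, hid⟩ := h
  obtain ⟨pa, L', I', N', hc', hN'⟩ := hc.exists_isMeasurableConstruction hG.connected
  have hz : ‖Complex.exp (t * Complex.I)‖ ≤ 1 := (Complex.norm_exp_ofReal_mul_I t).le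
  have hs : Measurable fun x : V → ℕ => ((∑ v, x v : ℕ) : ℝ) := .of_discrete
  have hid' := hid.comp hs
  rw [totalExponent_apply, ← hc'.integral_prod_pow hG fun _ => hz]
  have hmap : (P.map fun ω => ((∑ v, N v ω : ℕ) : ℝ)) =
      P₀.map fun ω => ((∑ v, N₀ v ω : ℕ) : ℝ) := hid'.map_eq
  have hm₀ : AEMeasurable (fun ω => ((∑ v, N₀ v ω : ℕ) : ℝ)) P₀ := hid'.aemeasurable_snd
  rw [hmap, charFun_apply_real, integral_map hm₀ (by fun_prop)]
  refine integral_congr_ae ?_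
  filter_upwards [hN'] with ω hω
  simp only [hω]
  rw [Finset.prod_pow_eq_pow_sum, ← Complex.exp_nat_mul]
  push_cast
  ring_nf

end TreePoisson

theorem mainTheorem9 {V : Type*} [Fintype V] (G : SimpleGraph V) (hG : G.IsTree)
    (lam : ℝ≥0) (hlam : 0 < lam) (α α' : G.edgeSet → unitInterval)
    {Ω Ω' : Type*} [MeasurableSpace Ω] [MeasurableSpace Ω']
    (P : Measure Ω) [IsProbabilityMeasure P] (P' : Measure Ω') [IsProbabilityMeasure P']
    (N : V → Ω → ℕ) (N' : V → Ω' → ℕ)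
    (hN : TreePoisson.IsMPMRF G lam α P N) (hN' : TreePoisson.IsMPMRF G lam α' P' N')
    (hα : ∀ e : G.edgeSet, α e ≤ α' e) :
    TreePoisson.ConvexOrder P (fun ω => ((∑ v, N v ω : ℕ) : ℝ))
      P' (fun ω => ((∑ v, N' v ω : ℕ) : ℝ)) :=
  (TreePoisson.cxExp_totalExponent_of_le hG.isAcyclic lam hα).convexOrder hN.aemeasurable
    hN'.aemeasurable (hN.charFun_eq hG) (hN'.charFun_eq hG)
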